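/- Let $K\ge 2$, $\sigma>0$, and consider a $K$-armed bandit in which arm $i$ has the Gaussian reward distribution $\mathcal N(\mu_i,\sigma^2)$, with a unique arm $i^*$ of largest mean $\mu^*=\mu_{i^*}$. Let $\Delta_{\min}=\min_{i\ne i^*}(\mu^*-\mu_i)$ and let $\Phi$ be the distribution function of $\mathcal N(0,1)$. *Attack model.* In each round $t=1,2,\dots,T$ the player pulls an arm $I_t$, and the clean reward $\tilde X_{I_t,t}\sim\mathcal N(\mu_{I_t},\sigma^2)$ is generated independently of the past. With probability $\rho>0$, independently of the past, of the player's choice and of the clean rewards, the adversary attacks and the player observes $X_{t}=\tilde X_{I_t,t}+\eta_t$; otherwise the player observes $X_{t}=\tilde X_{I_t,t}$. The attack value $\eta_t\in\mathbb R$ is arbitrary and unbounded; it may depend on everything that has happened up to and including round $t$ and on private randomness of the adversary. *Algorithm (med-$\epsilon$-greedy with parameter $c$).* In the first $\lceil c\rceil K$ rounds each arm is pulled $\lceil c\rceil$ times. In each round $t>\lceil c\rceil K$, with probability $cK/t$ an arm is picked uniformly at random from $\{1,\dots,K\}$, and with probability $1-cK/t$ an arm $j$ that maximizes $\mathrm{med}_j(t-1)$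 is pulled (ties broken arbitrarily), where $\mathrm{med}_j(t-1)=\inf\{x:\hat F(x)\ge 1/2\}$ is the median of the empirical distribution $\hat F$ of the rewards observed from arm $j$ up to round $t-1$; these random choices are independent of the past and of the clean rewards and the attack decision of round $t$. Let $R_T=\mu^*T-\sum_{t=1}^T\mu_{I_t}$ be the regret and $\bar R_T=\mathbb E[R_T]$ the pseudo-regret. Suppose $0<\rho<\Phi\!\left(\frac{\Delta_{\min}}{4\sigma}\right)-\frac12$ and $$c>\max\left\{10,\ \frac{1}{\left(\Phi(\frac{\Delta_{\min}}{2\sigma})-\Phi(\frac{\Delta_{\min}}{4\sigma})\right)^2},\ \frac{1}{\left(\Phi(\frac{\Delta_{\min}}{4\sigma})-\frac12-\rho\right)^2}\right\}.$$ Then there are constants $M,\zeta>0$, depending only on $K$, $(\mu_i)$, $\sigma$, $\rho$ and $c$ (in particular not on the adversary), such that for all integers $T\ge\zeta$, $$\bar R_T\le M\log T,$$ that is, $\bar R_T=\mathcal O(\log T)$. Furthermore, there are such constants $M,\zeta>0$, also independent of $\delta$, such that for all integers $T\ge\zeta$ and all $\delta\in(0,1)$, with probability at least $1-\delta$ over rewards,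 attacks and the algorithm's randomization, $$R_T\le M\left(\log T+\frac1\delta\right).$$ -/

import Mathlib

open MeasureTheory ProbabilityTheory

universe u

noncomputable section

namespace MedianBandit

/-- The generalized `p`-quantile `inf {x : F x ≥ p}` of a distribution function `F`. -/
def quantile (p : ℝ) (F : ℝ → ℝ) : ℝ := sInf {x | p ≤ F x}

/-- The empirical distribution function of the samples `x τ`, `τ ∈ s`. -/
def empiricalCDF (s : Finset ℕ) (x : ℕ → ℝ) (y : ℝ) : ℝ :=
  ((s.filter fun τ => x τ ≤ y).card : ℝ) / (s.card : ℝ)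

/-- The sample median of the samples `x τ`, `τ ∈ s`. -/
def sampleMedian (s : Finset ℕ) (x : ℕ → ℝ) : ℝ := quantile (1 / 2) (empiricalCDF s x)

/-- The cumulative distribution function of the standard Gaussian distribution. -/
def Phi (x : ℝ) : ℝ := cdf (gaussianReal 0 1) x

/-- The smallest gap `μ i - μ j` over the arms `j ≠ i`. -/
def minGap {K : ℕ} (μ : Fin K → ℝ) (i : Fin K) : ℝ := ⨅ j : {j : Fin K // j ≠ i}, (μ i - μ j)

/-- All random quantities in a play of a `K`-armed bandit under attack by an `ε`-greedy player.
Rounds are numbered `1, 2, …`; index `0` is unused. -/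
structure Play (K : ℕ) (Ω : Type u) where
  /-- the clean rewards of all arms in a round -/
  clean : ℕ → Ω → Fin K → ℝ
  /-- whether the adversary attacks in a round -/
  attack : ℕ → Ω → Bool
  /-- the attack value of a round, added to the reward if the adversary attacks -/
  value : ℕ → Ω → ℝ
  /-- whether the player explores in a round -/
  explore : ℕ → Ω → Bool
  /-- the arm pulled in a round if the player explores -/
  uniformArm : ℕ → Ω → Fin K
  /-- the arm pulled in a round if the player exploits -/
  greedyArm : ℕ → Ω → Fin K
  /-- the order of the pulls in the initialization rounds -/
  init : ℕ → Fin K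

namespace Play

variable {K : ℕ} {Ω : Type u}

/-- The arm `I_t` pulled in round `t`: the initialization consists of the first `⌈c⌉ K` rounds. -/
def arm (D : Play K Ω) (c : ℝ) (t : ℕ) (ω : Ω) : Fin K :=
  if t ≤ ⌈c⌉₊ * K then D.init t
  else if D.explore t ω = true then D.uniformArm t ω
  else D.greedyArm t ω

/-- The reward that the player observes in round `t`. -/
def observed (D : Play K Ω) (c : ℝ) (t : ℕ) (ω : Ω) : ℝ :=
  D.clean t ω (D.arm c t ω) + if D.attack t ω = true then D.value t ω else 0

/-- The set of rounds up to round `t` in which arm `i` is pulled. -/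
def pullRounds (D : Play K Ω) (c : ℝ) (i : Fin K) (t : ℕ) (ω : Ω) : Finset ℕ :=
  (Finset.Icc 1 t).filter fun τ => D.arm c τ ω = i

/-- The sample median of the rewards observed from arm `i` up to round `t`. -/
def med (D : Play K Ω) (c : ℝ) (i : Fin K) (t : ℕ) (ω : Ω) : ℝ :=
  sampleMedian (D.pullRounds c i t ω) fun τ => D.observed c τ ω

/-- The regret `R_T` with respect to the arm `i`. -/
def regret (D : Play K Ω) (c : ℝ) (μ : Fin K → ℝ) (i : Fin K) (T : ℕ) (ω : Ω) : ℝ :=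
  μ i * T - ∑ t ∈ Finset.Icc 1 T, μ (D.arm c t ω)

/-- The pseudo-regret with respect to the arm `i`. -/
def pseudoRegret [MeasurableSpace Ω] (D : Play K Ω) (P : Measure Ω) (c : ℝ) (μ : Fin K → ℝ)
    (i : Fin K) (T : ℕ) : ℝ :=
  μ i * T - ∫ ω, (∑ t ∈ Finset.Icc 1 T, μ (D.arm c t ω)) ∂P

end Play

/-- `D` is a play over `T` rounds of the median-based `ε`-greedy algorithm with exploration
parameter `c`, on the bandit whose arm `i` has the reward distribution `N(μ i, σ ^ 2)`, against an
adversary that attacks with probability `ρ` in each round. The `σ`-algebra `ℱ t` holds what may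
have influenced the play up to the end of round `t`; private randomness of the adversary is
allowed in it. -/
structure IsMedEpsGreedy {K : ℕ} {Ω : Type u} [mΩ : MeasurableSpace Ω] (P : Measure Ω)
    (ℱ : Filtration ℕ mΩ) (μ : Fin K → ℝ) (σ ρ c : ℝ) (T : ℕ) (D : Play K Ω) : Prop where
  measurable_clean : ∀ t < T, Measurable[ℱ (t + 1)] (D.clean (t + 1))
  measurable_attack : ∀ t < T, Measurable[ℱ (t + 1)] (D.attack (t + 1))
  measurable_explore : ∀ t < T, Measurable[ℱ (t + 1)] (D.explore (t + 1))
  measurable_uniformArm : ∀ t < T, Measurable[ℱ (t + 1)] (D.uniformArm (t + 1))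
  /-- The attack value of a round is an arbitrary, unbounded function of everything that has
  happened up to and including this round. -/
  measurable_value : ∀ t < T, Measurable[ℱ (t + 1)] (D.value (t + 1))
  /-- The greedy arm of a round is determined before that round. -/
  measurable_greedyArm : ∀ t < T, Measurable[ℱ t] (D.greedyArm (t + 1))
  /-- The past, the vector of clean rewards, the decision to attack, the decision to explore and
  the arm of exploration are mutually independent in each round. -/
  indep : ∀ t < T, iIndep
    ![(ℱ t : MeasurableSpace Ω),
      MeasurableSpace.comap (D.clean (t + 1)) inferInstance,
      MeasurableSpace.comap (D.attack (t + 1)) inferInstance,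
      MeasurableSpace.comap (D.explore (t + 1)) inferInstance,
      MeasurableSpace.comap (D.uniformArm (t + 1)) inferInstance] P
  /-- The clean rewards of arm `i` have the law `N(μ i, σ ^ 2)`. -/
  law_clean : ∀ t < T, ∀ i,
    P.map (fun ω => D.clean (t + 1) ω i) = gaussianReal (μ i) (σ ^ 2).toNNReal
  law_attack : ∀ t < T, P.real {ω | D.attack (t + 1) ω = true} = ρ
  /-- After the initialization, the player explores in round `t` with probability `c K / t`. -/
  law_explore : ∀ t < T, ⌈c⌉₊ * K < t + 1 →
    P.real {ω | D.explore (t + 1) ω = true} = c * K / ((t + 1 : ℕ) : ℝ)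
  law_uniformArm : ∀ t < T, ∀ i, P.real {ω | D.uniformArm (t + 1) ω = i} = 1 / K
  /-- The initialization pulls each arm `⌈c⌉` times. -/
  init_count : ∀ i, ((Finset.Icc 1 (⌈c⌉₊ * K)).filter fun t => D.init t = i).card = ⌈c⌉₊
  /-- The greedy arm maximizes the current sample median; ties are broken arbitrarily. -/
  greedy_max : ∀ t < T, ⌈c⌉₊ * K < t + 1 → ∀ ω j,
    D.med c j t ω ≤ D.med c (D.greedyArm (t + 1) ω) t ω

end MedianBandit

end

/-! Apart from the initialization, regret arises only in exploration rounds and in rounds whose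
greedy arm is wrong. Exploration contributes about `c * K * log T` rounds, so it remains to show
that the expected number of greedy errors is bounded.

Put the threshold `x = μ iStar - d / 2`, with `d` the smallest gap, and call a pull corrupted if it
is attacked or if its clean reward lies on the wrong side of `x`. Attacked pulls count as corrupted
whatever the attack value, so the adversary's strategy plays no role. Each pull is corrupted with
conditional probability at most `1 / 2 - g`, where `g = Phi (d / (4 * σ)) - 1 / 2 - ρ`. If a sample
median is on the wrong side of `x`, at least half of the pulls of that arm are corrupted
(`one_le_score`).

This event is controlled by a supermartingale rather than by a concentration bound for a random
number of samples. `Play.score` multiplies by `a = 1 + 2 * g` at corrupted pulls and by `a⁻¹` at the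
others; it is at least `1` on the bad event, and each pull lowers its conditional mean by a factor
of at most `1 - 2 * g ^ 2`. Exploration pulls any given arm in round `t + 1` with probability at
least `c / (t + 1)`, so `c * g ^ 2 ≥ 1` shrinks the mean score by `1 - 2 / (t + 1)`. Hence the mean
is `O(1 / t ^ 2)` (`integral_score_le`), and Markov's inequality with a union bound over arms makes
the error probabilities summable.

For the high-probability bound, Markov's inequality applied to the number of greedy errors costs `1
/ δ`. The number of explorations is handled through its exponential moment, which keeps `1 / δ` from
multiplying `log T`. -/

namespace MedianBandit

/-! ### Sample medians and counts of samples -/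

section Median

variable {s : Finset ℕ} {x : ℕ → ℝ} {y : ℝ}

lemma half_le_empiricalCDF_iff (hs : s.Nonempty) :
    1 / 2 ≤ empiricalCDF s x y ↔ s.card ≤ 2 * (s.filter fun τ => x τ ≤ y).card := by
  have h : (0 : ℝ) < s.card := by exact_mod_cast hs.card_pos
  rw [empiricalCDF, le_div_iff₀ h]
  constructor
  · intro h1
    have : (s.card : ℝ) ≤ 2 * ((s.filter fun τ => x τ ≤ y).card : ℝ) := by linarith
    exact_mod_cast this
  · intro h1
    have : (s.card : ℝ) ≤ 2 * ((s.filter fun τ => x τ ≤ y).card : ℝ) := by exact_mod_cast h1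
    linarith

lemma bddBelow_half_le_empiricalCDF (hs : s.Nonempty) :
    BddBelow {z | 1 / 2 ≤ empiricalCDF s x z} := by
  refine ⟨s.inf' hs x, fun z hz => ?_⟩
  by_contra! hlt
  rw [Set.mem_ofPred_eq, half_le_empiricalCDF_iff hs] at hz
  have h0 : (s.filter fun τ => x τ ≤ z) = ∅ := by
    refine Finset.filter_false_of_mem fun τ hτ h => ?_
    exact absurd (Finset.inf'_le x hτ) (not_le.2 (h.trans_lt hlt))
  rw [h0] at hz
  simp at hz
  exact hs.ne_empty hz

/-- If more than half of the samples were below `y`, the largest of these would already be a point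
where the empirical CDF reaches `1 / 2`, forcing the median below `y`. -/
lemma card_le_of_le_sampleMedian (hs : s.Nonempty) (h : y ≤ sampleMedian s x) :
    s.card ≤ 2 * (s.filter fun τ => y ≤ x τ).card := by
  by_contra! hlt
  have hsplit := Finset.card_filter_add_card_filter_not (s := s) (fun τ => y ≤ x τ)
  have hne : (s.filter fun τ => ¬ y ≤ x τ).Nonempty := Finset.card_pos.1 (by omega)
  set z := (s.filter fun τ => ¬ y ≤ x τ).sup' hne x with hz
  have hzy : z < y := by
    rw [hz, Finset.sup'_lt_iff]
    intro τ hτ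
    exact not_le.1 (Finset.mem_filter.1 hτ).2
  have hsub : (s.filter fun τ => ¬ y ≤ x τ) ⊆ s.filter fun τ => x τ ≤ z := fun τ hτ =>
    Finset.mem_filter.2 ⟨(Finset.mem_filter.1 hτ).1, Finset.le_sup' x hτ⟩
  have hcard := Finset.card_le_card hsub
  have hmem : 1 / 2 ≤ empiricalCDF s x z := (half_le_empiricalCDF_iff hs).2 (by omega)
  have : sampleMedian s x ≤ z := csInf_le (bddBelow_half_le_empiricalCDF hs) hmem
  linarith

lemma card_le_of_sampleMedian_lt (hs : s.Nonempty) (h : sampleMedian s x < y) :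
    s.card ≤ 2 * (s.filter fun τ => x τ < y).card := by
  have hne : {z | 1 / 2 ≤ empiricalCDF s x z}.Nonempty := by
    refine ⟨s.sup' hs x, (half_le_empiricalCDF_iff hs).2 ?_⟩
    rw [Finset.filter_true_of_mem fun τ hτ => Finset.le_sup' x hτ]
    omega
  obtain ⟨z, hz, hzy⟩ := exists_lt_of_csInf_lt hne h
  refine ((half_le_empiricalCDF_iff hs).1 hz).trans ?_
  gcongr

end Median

/-! ### Gaussian tails in terms of `Phi` -/

section Gaussian

lemma measureReal_Iic_gaussianReal {m σ : ℝ} (hσ : 0 < σ) (x : ℝ) :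
    (gaussianReal m (σ ^ 2).toNNReal).real (Set.Iic x) = Phi ((x - m) / σ) := by
  have hmap : gaussianReal m (σ ^ 2).toNNReal = ((gaussianReal 0 1).map (σ * ·)).map (· + m) := by
    rw [gaussianReal_map_const_mul, gaussianReal_map_add_const]
    congr 1
    · simp
    · ext; simp [sq_nonneg]
  rw [Phi, cdf_eq_real, hmap, map_measureReal_apply (by fun_prop) measurableSet_Iic,
    map_measureReal_apply (by fun_prop) (measurableSet_Iic.preimage (by fun_prop))]
  congr 1
  ext z
  simp only [Set.mem_preimage, Set.mem_Iic, le_div_iff₀ hσ]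
  constructor <;> intro h <;> linarith

lemma Phi_neg (z : ℝ) : Phi (-z) = 1 - Phi z := by
  have hneg : (gaussianReal 0 1).map (fun y => -y) = gaussianReal 0 1 := by
    simpa using gaussianReal_map_neg (μ := 0) (v := 1)
  have : NullSingletonClass (gaussianReal 0 1) := nullSingletonClass_gaussianReal one_ne_zero
  rw [Phi, Phi, cdf_eq_real, cdf_eq_real, ← probReal_compl_eq_one_sub measurableSet_Iic]
  conv_lhs => rw [← hneg]
  rw [map_measureReal_apply (by fun_prop) measurableSet_Iic]
  have : (fun y : ℝ => -y) ⁻¹' Set.Iic (-z) = Set.Ici z := by ext; simp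
  rw [this, Set.compl_Iic]
  exact (measureReal_congr Ioi_ae_eq_Ici).symm

lemma Phi_mono : Monotone Phi := monotone_cdf _

lemma measureReal_Iio_gaussianReal_le {m σ x d : ℝ} (hσ : 0 < σ) (h : x ≤ m - d) :
    (gaussianReal m (σ ^ 2).toNNReal).real (Set.Iio x) ≤ 1 - Phi (d / σ) := by
  rw [← Phi_neg, ← neg_div]
  refine (measureReal_mono Set.Iio_subset_Iic_self).trans ?_
  rw [measureReal_Iic_gaussianReal hσ]
  exact Phi_mono (by gcongr; linarith)

lemma measureReal_Ici_gaussianReal_le {m σ x d : ℝ} (hσ : 0 < σ) (h : m + d ≤ x) :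
    (gaussianReal m (σ ^ 2).toNNReal).real (Set.Ici x) ≤ 1 - Phi (d / σ) := by
  have : NullSingletonClass (gaussianReal m (σ ^ 2).toNNReal) :=
    nullSingletonClass_gaussianReal (by simp [hσ.ne'])
  rw [← measureReal_congr (Ioi_ae_eq_Ici (a := x)), ← Set.compl_Iic,
    probReal_compl_eq_one_sub measurableSet_Iic, measureReal_Iic_gaussianReal hσ]
  have : Phi (d / σ) ≤ Phi ((x - m) / σ) := Phi_mono (by gcongr; linarith)
  linarith

end Gaussian

/-! ### Independence and two elementary sums -/

lemma integral_mul_of_indep {Ω : Type*} {m₁ m₂ mΩ : MeasurableSpace Ω} {P : Measure Ω}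
    (h₁ : m₁ ≤ mΩ) (h₂ : m₂ ≤ mΩ) (hind : Indep m₁ m₂ P) {X Y : Ω → ℝ}
    (hX : Measurable[m₁] X) (hY : Measurable[m₂] Y) :
    ∫ ω, X ω * Y ω ∂P = (∫ ω, X ω ∂P) * ∫ ω, Y ω ∂P := by
  have hXY : IndepFun X Y P := by
    rw [IndepFun_iff_Indep]
    exact indep_of_indep_of_le_left (indep_of_indep_of_le_right hind hY.comap_le) hX.comap_le
  exact hXY.integral_fun_mul_eq_mul_integral (hX.mono h₁ le_rfl).aestronglyMeasurable
    (hY.mono h₂ le_rfl).aestronglyMeasurable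

/-- Each step uses `1 - 1 / y ≤ log y` at `y = (m + 1) / m`. -/
lemma sum_Ioc_inv_le_log {n m : ℕ} (hn : 1 ≤ n) (hm : n ≤ m) :
    ∑ t ∈ Finset.Ioc n m, (1 / (t : ℝ)) ≤ Real.log m := by
  induction m, hm using Nat.le_induction with
  | base => simpa using Real.log_natCast_nonneg n
  | succ m hm ih =>
    rw [Finset.sum_Ioc_succ_top hm]
    have hm0 : (0 : ℝ) < m := by exact_mod_cast hn.trans hm
    have h := Real.one_sub_inv_le_log_of_pos (x := ((m + 1 : ℕ) : ℝ) / m) (by positivity)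
    rw [Real.log_div (by positivity) hm0.ne'] at h
    have : 1 - (((m + 1 : ℕ) : ℝ) / m)⁻¹ = 1 / ((m + 1 : ℕ) : ℝ) := by
      push_cast; field_simp; ring
    linarith

lemma sum_Ico_inv_mul_pred_le {n m : ℕ} (hn : 2 ≤ n) :
    ∑ t ∈ Finset.Ico n m, (1 / ((t : ℝ) * (t - 1))) ≤ 1 := by
  have hn' : (2 : ℝ) ≤ n := by exact_mod_cast hn
  rcases le_total m n with h | h
  · simp [Finset.Ico_eq_empty_of_le h]
  have key : ∑ t ∈ Finset.Ico n m, (1 / ((t : ℝ) * (t - 1)))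
      = 1 / ((n : ℝ) - 1) - 1 / ((m : ℝ) - 1) := by
    induction m, h using Nat.le_induction with
    | base => simp
    | succ m hm ih =>
      have hm' : (n : ℝ) ≤ m := by exact_mod_cast hm
      have h1 : (m : ℝ) - 1 ≠ 0 := by linarith
      have h2 : (m : ℝ) ≠ 0 := by linarith
      rw [Finset.sum_Ico_succ_top hm, ih]
      push_cast
      rw [add_sub_cancel_right]
      field_simp
      ring
  have hm' : (n : ℝ) ≤ m := by exact_mod_cast h
  have h1 : 1 / ((n : ℝ) - 1) ≤ 1 := by rw [div_le_one] <;> linarith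
  have h2 : 0 ≤ 1 / ((m : ℝ) - 1) := one_div_nonneg.2 (by linarith)
  linarith

/-! ### Multiplicative scores, pathwise -/

open scoped Classical in
/-- The multiplicative score of arm `i` after `t` rounds: a pull whose observation may lie in `B`
because of an attack or of the clean reward contributes `a`, every other pull contributes `a⁻¹`. -/
noncomputable def Play.score {K : ℕ} {Ω : Type u} (D : Play K Ω) (c : ℝ) (i : Fin K) (B : Set ℝ)
    (a : ℝ) (t : ℕ) (ω : Ω) : ℝ :=
  ∏ τ ∈ Finset.Icc 1 t, if D.arm c τ ω = i then
    (if D.attack τ ω = true ∨ D.clean τ ω i ∈ B then a else a⁻¹) else 1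

/-- Two to the number of exploration rounds in `(n, t]`. -/
noncomputable def Play.exploreScore {K : ℕ} {Ω : Type u} (D : Play K Ω) (n t : ℕ) (ω : Ω) : ℝ :=
  ∏ τ ∈ Finset.Ioc n t, if D.explore τ ω = true then 2 else 1

/-- The information on the past and the four sources of randomness of round `t + 1`. -/
abbrev roundInfo {K : ℕ} {Ω : Type u} [mΩ : MeasurableSpace Ω] (ℱ : Filtration ℕ mΩ)
    (D : Play K Ω) (t : ℕ) : Fin 5 → MeasurableSpace Ω :=
  ![(ℱ t : MeasurableSpace Ω),
    MeasurableSpace.comap (D.clean (t + 1)) inferInstance,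
    MeasurableSpace.comap (D.attack (t + 1)) inferInstance,
    MeasurableSpace.comap (D.explore (t + 1)) inferInstance,
    MeasurableSpace.comap (D.uniformArm (t + 1)) inferInstance]

namespace Play

variable {K : ℕ} {Ω : Type u} (D : Play K Ω) {c a : ℝ} {i : Fin K} {B : Set ℝ} {n t : ℕ} {ω : Ω}

lemma score_pos (ha : 0 < a) : 0 < D.score c i B a t ω :=
  Finset.prod_pos fun τ _ => by split_ifs <;> positivity

lemma score_le (ha : 1 ≤ a) : D.score c i B a t ω ≤ a ^ t := by
  have : D.score c i B a t ω ≤ ∏ _τ ∈ Finset.Icc 1 t, a := by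
    refine Finset.prod_le_prod (fun τ _ => ?_) fun τ _ => ?_
    · split_ifs <;> positivity
    · split_ifs
      · exact le_rfl
      · exact (inv_le_one_of_one_le₀ ha).trans ha
      · exact ha
  simpa using this

-- This form separates what the past and the choice of arm determine from what the attack and the
-- clean reward of the new round determine, so that independence applies to the product.
open scoped Classical in
lemma score_succ : D.score c i B a (t + 1) ω = D.score c i B a t ω -
    (D.score c i B a t ω * if D.arm c (t + 1) ω = i then 1 else 0) *
      (1 - if D.attack (t + 1) ω = true ∨ D.clean (t + 1) ω i ∈ B then a else a⁻¹) := by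
  rw [score, Finset.prod_Icc_succ_top (by omega), ← score]
  split_ifs <;> ring

-- The score is `a` to the number of corrupted pulls minus the number of uncorrupted ones.
open scoped Classical in
lemma one_le_score (ha : 1 ≤ a)
    (h : (D.pullRounds c i t ω).card ≤ 2 * ((D.pullRounds c i t ω).filter fun τ =>
      D.attack τ ω = true ∨ D.clean τ ω i ∈ B).card) : 1 ≤ D.score c i B a t ω := by
  have hsplit := Finset.card_filter_add_card_filter_not (s := D.pullRounds c i t ω)
    (fun τ => D.attack τ ω = true ∨ D.clean τ ω i ∈ B)
  rw [score, ← Finset.prod_filter]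
  change 1 ≤ ∏ τ ∈ D.pullRounds c i t ω, _
  rw [Finset.prod_ite, Finset.prod_const, Finset.prod_const, inv_pow,
    ← div_eq_mul_inv, one_le_div (by positivity)]
  exact pow_le_pow_right₀ ha (by omega)

lemma exploreScore_pos : 0 < D.exploreScore n t ω :=
  Finset.prod_pos fun τ _ => by split_ifs <;> positivity

lemma exploreScore_eq :
    D.exploreScore n t ω = 2 ^ ((Finset.Ioc n t).filter fun τ => D.explore τ ω = true).card := by
  rw [exploreScore, Finset.prod_ite]
  simp

lemma exploreScore_le : D.exploreScore n t ω ≤ 2 ^ t := by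
  rw [exploreScore_eq]
  refine pow_le_pow_right₀ one_le_two ((Finset.card_filter_le _ _).trans ?_)
  simp

lemma exploreScore_succ (h : n ≤ t) : D.exploreScore n (t + 1) ω = D.exploreScore n t ω +
    D.exploreScore n t ω * if D.explore (t + 1) ω = true then 1 else 0 := by
  rw [exploreScore, Finset.prod_Ioc_succ_top h, ← exploreScore]
  split_ifs <;> ring

lemma measurable_arm {m : MeasurableSpace Ω} (hE : Measurable[m] (D.explore t))
    (hU : Measurable[m] (D.uniformArm t)) (hG : Measurable[m] (D.greedyArm t)) :
    Measurable[m] (D.arm c t) := by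
  unfold arm
  split_ifs
  · exact measurable_const
  · exact Measurable.ite (hE (measurableSet_singleton true)) hU hG

lemma measurableSet_corrupted {m : MeasurableSpace Ω}
    (hB : MeasurableSet B) (hA : Measurable[m] (D.attack t)) (hC : Measurable[m] (D.clean t)) :
    MeasurableSet[m] {ω | D.attack t ω = true ∨ D.clean t ω i ∈ B} :=
  (hA (measurableSet_singleton true)).union (((measurable_pi_apply i).comp hC) hB)

end Play

lemma integrable_mul_ite {Ω : Type*} [MeasurableSpace Ω] {P : Measure Ω} {X : Ω → ℝ}
     (hX : Integrable X P) {p : Ω → Prop} [DecidablePred p]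
    (hp : MeasurableSet {ω | p ω}) : Integrable (fun ω => X ω * if p ω then 1 else 0) P := by
  have : (fun ω => X ω * if p ω then 1 else 0) = {ω | p ω}.indicator X := by
    ext ω; simp [Set.indicator_apply]
  rw [this]
  exact hX.indicator hp

lemma integral_ite {Ω : Type*} [MeasurableSpace Ω] {P : Measure Ω} {p : Ω → Prop}
    [DecidablePred p] (hp : MeasurableSet {ω | p ω}) :
    ∫ ω, (if p ω then (1 : ℝ) else 0) ∂P = P.real {ω | p ω} := by
  have : (fun ω => if p ω then (1 : ℝ) else 0) = {ω | p ω}.indicator 1 := by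
    ext ω; simp [Set.indicator_apply]
  rw [this, integral_indicator_one hp]

/-! ### Expected scores: measurability, recursion and decay -/

namespace IsMedEpsGreedy

variable {K : ℕ} {Ω : Type u} [mΩ : MeasurableSpace Ω] {P : Measure Ω}
  {ℱ : Filtration ℕ mΩ} {μ : Fin K → ℝ} {σ ρ c : ℝ} {T : ℕ} {D : Play K Ω}

lemma roundInfo_le (H : IsMedEpsGreedy P ℱ μ σ ρ c T D) {t : ℕ} (ht : t < T) (j : Fin 5) :
    roundInfo ℱ D t j ≤ mΩ := by
  fin_cases j
  · exact ℱ.le t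
  · exact ((H.measurable_clean t ht).mono (ℱ.le _) le_rfl).comap_le
  · exact ((H.measurable_attack t ht).mono (ℱ.le _) le_rfl).comap_le
  · exact ((H.measurable_explore t ht).mono (ℱ.le _) le_rfl).comap_le
  · exact ((H.measurable_uniformArm t ht).mono (ℱ.le _) le_rfl).comap_le

lemma measurable_arm (H : IsMedEpsGreedy P ℱ μ σ ρ c T D) {t : ℕ} (ht : t < T) :
    Measurable[ℱ (t + 1)] (D.arm c (t + 1)) :=
  D.measurable_arm (H.measurable_explore t ht) (H.measurable_uniformArm t ht)
    ((H.measurable_greedyArm t ht).mono (ℱ.mono (Nat.le_succ t)) le_rfl)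

lemma integral_mul (H : IsMedEpsGreedy P ℱ μ σ ρ c T D) {t : ℕ} (ht : t < T) {S S' : Set (Fin 5)}
    (hS : Disjoint S S') {X Y : Ω → ℝ} (hX : Measurable[⨆ j ∈ S, roundInfo ℱ D t j] X)
    (hY : Measurable[⨆ j ∈ S', roundInfo ℱ D t j] Y) :
    ∫ ω, X ω * Y ω ∂P = (∫ ω, X ω ∂P) * ∫ ω, Y ω ∂P :=
  integral_mul_of_indep (iSup₂_le fun j _ => H.roundInfo_le ht j)
    (iSup₂_le fun j _ => H.roundInfo_le ht j)
    (indep_iSup_of_disjoint (H.roundInfo_le ht) (H.indep t ht) hS) hX hY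

lemma measurable_score (H : IsMedEpsGreedy P ℱ μ σ ρ c T D) {i : Fin K} {B : Set ℝ}
    (hB : MeasurableSet B) {a : ℝ} {t : ℕ} (ht : t ≤ T) :
    Measurable[ℱ t] (D.score c i B a t) := by
  unfold Play.score
  refine Finset.measurable_fun_prod _ fun τ hτ => ?_
  obtain ⟨h1, h2⟩ := Finset.mem_Icc.1 hτ
  obtain ⟨s, rfl⟩ := Nat.exists_eq_add_of_le' h1
  have hs : s < T := by omega
  refine Measurable.mono (ma := ℱ (s + 1)) ?_ (ℱ.mono h2) le_rfl
  exact Measurable.ite (H.measurable_arm hs (measurableSet_singleton i))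
    (Measurable.ite (D.measurableSet_corrupted hB (H.measurable_attack s hs)
      (H.measurable_clean s hs)) measurable_const measurable_const) measurable_const

lemma measurable_exploreScore (H : IsMedEpsGreedy P ℱ μ σ ρ c T D) {n t : ℕ} (ht : t ≤ T) :
    Measurable[ℱ t] (D.exploreScore n t) := by
  unfold Play.exploreScore
  refine Finset.measurable_fun_prod _ fun τ hτ => ?_
  obtain ⟨h1, h2⟩ := Finset.mem_Ioc.1 hτ
  obtain ⟨s, rfl⟩ := Nat.exists_eq_add_of_le' (show 1 ≤ τ by omega)
  have hs : s < T := by omega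
  refine Measurable.mono (ma := ℱ (s + 1)) ?_ (ℱ.mono h2) le_rfl
  exact Measurable.ite (H.measurable_explore s hs (measurableSet_singleton true))
    measurable_const measurable_const

variable [IsProbabilityMeasure P]

lemma integrable_score (H : IsMedEpsGreedy P ℱ μ σ ρ c T D) {i : Fin K} {B : Set ℝ}
    (hB : MeasurableSet B) {a : ℝ} (ha : 1 ≤ a) {t : ℕ} (ht : t ≤ T) :
    Integrable (D.score c i B a t) P := by
  refine Integrable.of_bound ((H.measurable_score hB ht).mono (ℱ.le t) le_rfl).aestronglyMeasurable
    (a ^ t) (ae_of_all _ fun ω => ?_)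
  rw [Real.norm_of_nonneg (D.score_pos (by linarith)).le]
  exact D.score_le ha

lemma integrable_exploreScore (H : IsMedEpsGreedy P ℱ μ σ ρ c T D) {n t : ℕ} (ht : t ≤ T) :
    Integrable (D.exploreScore n t) P := by
  refine Integrable.of_bound
    ((H.measurable_exploreScore ht).mono (ℱ.le t) le_rfl).aestronglyMeasurable
    (2 ^ t) (ae_of_all _ fun ω => ?_)
  rw [Real.norm_of_nonneg D.exploreScore_pos.le]
  exact D.exploreScore_le

lemma integral_exploreScore_succ (H : IsMedEpsGreedy P ℱ μ σ ρ c T D) {t : ℕ} (ht : t < T)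
    (h0 : ⌈c⌉₊ * K ≤ t) : ∫ ω, D.exploreScore (⌈c⌉₊ * K) (t + 1) ω ∂P =
      (∫ ω, D.exploreScore (⌈c⌉₊ * K) t ω ∂P) * (1 + c * K / ((t + 1 : ℕ) : ℝ)) := by
  have hE : MeasurableSet {ω | D.explore (t + 1) ω = true} :=
    (H.measurable_explore t ht).mono (ℱ.le _) le_rfl (measurableSet_singleton true)
  have hint := H.integrable_exploreScore (n := ⌈c⌉₊ * K) ht.le
  simp_rw [D.exploreScore_succ h0]
  rw [integral_add hint (integrable_mul_ite hint hE),
    H.integral_mul ht (S := {0}) (S' := {3}) (by simp), integral_ite hE,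
    H.law_explore t ht (by omega)]
  · ring
  · exact (H.measurable_exploreScore ht.le).mono
      (le_iSup₂_of_le (f := fun j _ => roundInfo ℱ D t j) 0 (by simp) le_rfl) le_rfl
  · refine Measurable.mono (ma := roundInfo ℱ D t 3) ?_
      (le_iSup₂_of_le (f := fun j _ => roundInfo ℱ D t j) 3 (by simp) le_rfl) le_rfl
    exact Measurable.ite (comap_measurable (D.explore (t + 1)) (measurableSet_singleton true))
      measurable_const measurable_const

/-- The mean is a product of factors `1 + c * K / s`, each at most `exp (c * K / s)`. -/
lemma integral_exploreScore_le (H : IsMedEpsGreedy P ℱ μ σ ρ c T D) (hc : 0 ≤ c) {t : ℕ}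
    (ht : t ≤ T) (h0 : ⌈c⌉₊ * K ≤ t) : ∫ ω, D.exploreScore (⌈c⌉₊ * K) t ω ∂P ≤
      Real.exp (c * K * ∑ s ∈ Finset.Ioc (⌈c⌉₊ * K) t, (1 / (s : ℝ))) := by
  induction t, h0 using Nat.le_induction with
  | base => simp [Play.exploreScore]
  | succ t h0 ih =>
    rw [H.integral_exploreScore_succ ht h0, Finset.sum_Ioc_succ_top h0,
      mul_add (c * (K : ℝ)), Real.exp_add]
    gcongr
    · exact ih (by omega)
    · rw [add_comm, mul_one_div]
      exact Real.add_one_le_exp _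

open scoped Classical in
lemma integral_score_succ (H : IsMedEpsGreedy P ℱ μ σ ρ c T D) {i : Fin K} {B : Set ℝ}
    (hB : MeasurableSet B) {a : ℝ} (ha : 1 ≤ a) {t : ℕ} (ht : t < T) :
    ∫ ω, D.score c i B a (t + 1) ω ∂P = (∫ ω, D.score c i B a t ω ∂P) -
      (∫ ω, (D.score c i B a t ω * if D.arm c (t + 1) ω = i then 1 else 0) ∂P) *
      ∫ ω, (1 - if D.attack (t + 1) ω = true ∨ D.clean (t + 1) ω i ∈ B then a else a⁻¹) ∂P := by
  have hA : MeasurableSet {ω | D.arm c (t + 1) ω = i} :=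
    (H.measurable_arm ht).mono (ℱ.le _) le_rfl (measurableSet_singleton i)
  have hint := H.integrable_score (i := i) hB ha ht.le
  -- The past, the exploration decision and the uniform arm fix the score and the next arm; the
  -- clean rewards and the attack decision fix the factor.
  rw [← H.integral_mul ht (S := {0, 3, 4}) (S' := {1, 2}) (by simp), ← integral_sub hint]
  · simp_rw [D.score_succ]
  · have : Integrable (D.score c i B a (t + 1)) P := H.integrable_score hB ha ht
    have h2 := hint.sub this
    refine h2.congr (ae_of_all _ fun ω => ?_)
    rw [Pi.sub_apply, D.score_succ]
    ring
  · have h3 (j : Fin 5) (hj : j ∈ ({0, 3, 4} : Set (Fin 5))) :=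
      le_iSup₂_of_le (f := fun j (_ : j ∈ ({0, 3, 4} : Set (Fin 5))) => roundInfo ℱ D t j)
        j hj le_rfl
    refine Measurable.mul ((H.measurable_score hB ht.le).mono (h3 0 (by simp)) le_rfl) ?_
    refine Measurable.ite (D.measurable_arm ?_ ?_ ?_ (measurableSet_singleton i))
      measurable_const measurable_const
    · exact (comap_measurable (D.explore (t + 1))).mono (h3 3 (by simp)) le_rfl
    · exact (comap_measurable (D.uniformArm (t + 1))).mono (h3 4 (by simp)) le_rfl
    · exact (H.measurable_greedyArm t ht).mono (h3 0 (by simp)) le_rfl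
  · have h3 (j : Fin 5) (hj : j ∈ ({1, 2} : Set (Fin 5))) :=
      le_iSup₂_of_le (f := fun j (_ : j ∈ ({1, 2} : Set (Fin 5))) => roundInfo ℱ D t j)
        j hj le_rfl
    refine Measurable.sub measurable_const (Measurable.ite (D.measurableSet_corrupted hB ?_ ?_)
      measurable_const measurable_const)
    · exact (comap_measurable (D.attack (t + 1))).mono (h3 2 (by simp)) le_rfl
    · exact (comap_measurable (D.clean (t + 1))).mono (h3 1 (by simp)) le_rfl

-- Exploitation pulls are discarded: exploring and drawing arm `i` has probability `(c * K / (t +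
-- 1)) * (1 / K)`, independently of the past.
open scoped Classical in
lemma le_integral_score_mul_arm (H : IsMedEpsGreedy P ℱ μ σ ρ c T D) (hK : 0 < K) {i : Fin K}
    {B : Set ℝ} (hB : MeasurableSet B) {a : ℝ} (ha : 1 ≤ a) {t : ℕ} (ht : t < T)
    (h0 : ⌈c⌉₊ * K ≤ t) : (∫ ω, D.score c i B a t ω ∂P) * (c / (t + 1)) ≤
      ∫ ω, (D.score c i B a t ω * if D.arm c (t + 1) ω = i then 1 else 0) ∂P := by
  have hA : MeasurableSet {ω | D.arm c (t + 1) ω = i} :=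
    (H.measurable_arm ht).mono (ℱ.le _) le_rfl (measurableSet_singleton i)
  have hE : MeasurableSet {ω | D.explore (t + 1) ω = true} :=
    (H.measurable_explore t ht).mono (ℱ.le _) le_rfl (measurableSet_singleton true)
  have hU : MeasurableSet {ω | D.uniformArm (t + 1) ω = i} :=
    (H.measurable_uniformArm t ht).mono (ℱ.le _) le_rfl (measurableSet_singleton i)
  have hint := H.integrable_score (i := i) hB ha ht.le
  have hmeas (j : Fin 5) (S : Set (Fin 5)) (hj : j ∈ S) :=
    le_iSup₂_of_le (f := fun j (_ : j ∈ S) => roundInfo ℱ D t j) j hj le_rfl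
  have hmE (S : Set (Fin 5)) (hS : 3 ∈ S) : Measurable[⨆ j ∈ S, roundInfo ℱ D t j]
      fun ω => if D.explore (t + 1) ω = true then (1 : ℝ) else 0 :=
    Measurable.ite ((comap_measurable (D.explore (t + 1))).mono (hmeas 3 S hS) le_rfl
      (measurableSet_singleton true)) measurable_const measurable_const
  have hmU (S : Set (Fin 5)) (hS : 4 ∈ S) : Measurable[⨆ j ∈ S, roundInfo ℱ D t j]
      fun ω => if D.uniformArm (t + 1) ω = i then (1 : ℝ) else 0 :=
    Measurable.ite ((comap_measurable (D.uniformArm (t + 1))).mono (hmeas 4 S hS) le_rfl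
      (measurableSet_singleton i)) measurable_const measurable_const
  have hEU : ∫ ω, ((if D.explore (t + 1) ω = true then (1 : ℝ) else 0) *
      if D.uniformArm (t + 1) ω = i then 1 else 0) ∂P = c / (t + 1) := by
    rw [H.integral_mul ht (S := {3}) (S' := {4}) (by simp) (hmE _ (by simp)) (hmU _ (by simp)),
      integral_ite hE, integral_ite hU, H.law_explore t ht (by omega), H.law_uniformArm t ht i]
    have : (K : ℝ) ≠ 0 := by exact_mod_cast hK.ne'
    push_cast
    field_simp
  have hsplit := H.integral_mul ht (S := {0}) (S' := {3, 4}) (by simp)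
    ((H.measurable_score (i := i) (a := a) hB ht.le).mono (hmeas 0 _ (by simp)) le_rfl)
    ((hmE _ (by simp)).mul (hmU _ (by simp)))
  simp only [Pi.mul_apply] at hsplit
  rw [← hEU, ← hsplit]
  have h1 : Integrable (fun ω => D.score c i B a t ω *
      ((if D.explore (t + 1) ω = true then (1 : ℝ) else 0) *
      if D.uniformArm (t + 1) ω = i then 1 else 0)) P := by
    simp_rw [← mul_assoc]
    exact integrable_mul_ite (integrable_mul_ite hint hE) hU
  refine integral_mono h1 (integrable_mul_ite hint hA) fun ω => ?_
  refine mul_le_mul_of_nonneg_left ?_ (D.score_pos (by linarith)).le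
  simp only [Play.arm, if_neg (show ¬ t + 1 ≤ ⌈c⌉₊ * K by omega)]
  split_ifs <;> simp

-- The mean is affine and decreasing in the corruption probability, so the worst case is `p = 1 / 2
-- - g`. There `1 + 2 * g = 2 * (1 - p)`, which makes the value exactly `2 * g ^ 2`.
open scoped Classical in
lemma le_integral_one_sub (H : IsMedEpsGreedy P ℱ μ σ ρ c T D) {i : Fin K} {B : Set ℝ}
    (hB : MeasurableSet B) {g : ℝ} (hg : 0 < g)
    (hprob : (gaussianReal (μ i) (σ ^ 2).toNNReal).real B + ρ ≤ 1 / 2 - g) {t : ℕ} (ht : t < T) :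
    2 * g ^ 2 ≤ ∫ ω, (1 - if D.attack (t + 1) ω = true ∨ D.clean (t + 1) ω i ∈ B
      then 1 + 2 * g else (1 + 2 * g)⁻¹) ∂P := by
  have hC : Measurable (D.clean (t + 1)) := (H.measurable_clean t ht).mono (ℱ.le _) le_rfl
  have hY := D.measurableSet_corrupted (i := i) hB
    ((H.measurable_attack t ht).mono (ℱ.le _) le_rfl) hC
  have hle : P.real {ω | D.attack (t + 1) ω = true ∨ D.clean (t + 1) ω i ∈ B} ≤ 1 / 2 - g := by
    refine (measureReal_union_le {ω | D.attack (t + 1) ω = true}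
      {ω | D.clean (t + 1) ω i ∈ B}).trans ?_
    rw [H.law_attack t ht]
    rw [← H.law_clean t ht i, map_measureReal_apply (by fun_prop) hB] at hprob
    change _ + P.real ((fun ω => D.clean (t + 1) ω i) ⁻¹' B) ≤ _
    linarith
  have hfun : ∀ ω, (1 - if D.attack (t + 1) ω = true ∨ D.clean (t + 1) ω i ∈ B
      then 1 + 2 * g else (1 + 2 * g)⁻¹) = (1 - (1 + 2 * g)⁻¹) - (1 + 2 * g - (1 + 2 * g)⁻¹) *
        (if D.attack (t + 1) ω = true ∨ D.clean (t + 1) ω i ∈ B then 1 else 0) := by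
    intro ω
    split_ifs <;> ring
  simp_rw [hfun]
  have h1 := integrable_mul_ite (P := P) (integrable_const (1 + 2 * g - (1 + 2 * g)⁻¹)) hY
  rw [integral_sub (integrable_const _) h1, integral_const_mul, integral_ite hY]
  have h2 : (1 + 2 * g)⁻¹ ≤ 1 := inv_le_one_of_one_le₀ (by linarith)
  have h3 := mul_le_mul_of_nonneg_left hle
    (show 0 ≤ 1 + 2 * g - (1 + 2 * g)⁻¹ by linarith)
  have h4 : (1 - (1 + 2 * g)⁻¹) - (1 + 2 * g - (1 + 2 * g)⁻¹) * (1 / 2 - g) = 2 * g ^ 2 := by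
    field_simp
    ring
  simp only [integral_const, probReal_univ, smul_eq_mul]
  linarith

/-- The supermartingale property alone; it supplies the starting value at the end of the
initialization. -/
lemma integral_score_le_one (H : IsMedEpsGreedy P ℱ μ σ ρ c T D) {i : Fin K} {B : Set ℝ}
    (hB : MeasurableSet B) {g : ℝ} (hg : 0 < g)
    (hprob : (gaussianReal (μ i) (σ ^ 2).toNNReal).real B + ρ ≤ 1 / 2 - g) {t : ℕ} (ht : t ≤ T) :
    ∫ ω, D.score c i B (1 + 2 * g) t ω ∂P ≤ 1 := by
  induction t with
  | zero => simp [Play.score]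
  | succ t ih =>
    rw [H.integral_score_succ hB (by linarith) ht]
    refine le_trans (sub_le_self _ (mul_nonneg (integral_nonneg fun ω => ?_) ?_)) (ih (by omega))
    · have := D.score_pos (c := c) (i := i) (B := B) (t := t) (ω := ω)
        (show 0 < 1 + 2 * g by linarith)
      dsimp only
      split_ifs <;> simp [this.le]
    · exact le_trans (by positivity) (H.le_integral_one_sub hB hg hprob ht)

/-- The weight `t * (t - 1)` exactly compensates the factor `1 - 2 / (t + 1)`, so the weighted mean
is nonincreasing. -/
lemma integral_score_le (H : IsMedEpsGreedy P ℱ μ σ ρ c T D) (hK : 0 < K) {i : Fin K} {B : Set ℝ}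
    (hB : MeasurableSet B) {g : ℝ} (hg : 0 < g) (hcg : 1 ≤ c * g ^ 2)
    (hprob : (gaussianReal (μ i) (σ ^ 2).toNNReal).real B + ρ ≤ 1 / 2 - g) {t : ℕ} (ht : t ≤ T)
    (h0 : ⌈c⌉₊ * K ≤ t) :
    (t : ℝ) * (t - 1) * ∫ ω, D.score c i B (1 + 2 * g) t ω ∂P ≤ ((⌈c⌉₊ * K : ℕ) : ℝ) ^ 2 := by
  have hnn (t : ℕ) : 0 ≤ ∫ ω, D.score c i B (1 + 2 * g) t ω ∂P :=
    integral_nonneg fun ω => (D.score_pos (by linarith)).le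
  induction t, h0 using Nat.le_induction with
  | base =>
    have h1 := H.integral_score_le_one hB hg hprob ht
    nlinarith [hnn (⌈c⌉₊ * K), Nat.cast_nonneg (α := ℝ) (⌈c⌉₊ * K),
      sq_nonneg ((⌈c⌉₊ * K : ℕ) : ℝ)]
  | succ t h0 ih =>
    refine le_trans ?_ (ih (by omega))
    have h1 := H.le_integral_score_mul_arm hK (i := i) hB (show 1 ≤ 1 + 2 * g by linarith) ht h0
    have h2 := H.le_integral_one_sub hB hg hprob ht
    have hI := hnn t
    rw [H.integral_score_succ hB (by linarith) ht]
    set I := ∫ ω, D.score c i B (1 + 2 * g) t ω ∂P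
    have hc0 : 0 ≤ c := by
      by_contra! h
      nlinarith [sq_nonneg g]
    have h3 := mul_le_mul h1 h2 (by positivity) (le_trans (by positivity) h1)
    have h4 : I * (2 / (t + 1)) ≤ I * (c / (t + 1)) * (2 * g ^ 2) := by
      have : I * (c / (t + 1)) * (2 * g ^ 2) = I * (2 / (t + 1)) * (c * g ^ 2) := by ring
      rw [this]
      exact le_mul_of_one_le_right (by positivity) hcg
    have h5 : ((t + 1 : ℕ) : ℝ) * ((t + 1 : ℕ) - 1) * (I - I * (2 / (t + 1)))
        = t * (t - 1) * I := by
      push_cast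
      field_simp
      ring
    rw [← h5]
    refine mul_le_mul_of_nonneg_left (by linarith) ?_
    push_cast
    rw [add_sub_cancel_right]
    positivity

end IsMedEpsGreedy

/-! ### Decomposition of the regret -/

namespace Play

variable {K : ℕ} {Ω : Type u} (D : Play K Ω)

/-- The number of exploration rounds in `(n, t]`. -/
def exploreCount (n t : ℕ) (ω : Ω) : ℕ :=
  ((Finset.Ioc n t).filter fun τ => D.explore τ ω = true).card

/-- The number of rounds in `(n, t]` whose greedy arm is not arm `i`. -/
def greedyErrors (i : Fin K) (n t : ℕ) (ω : Ω) : ℕ :=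
  ((Finset.Ioc n t).filter fun τ => D.greedyArm τ ω ≠ i).card

/-- The sum of all gaps serves as a crude bound on the loss of a single round. -/
lemma regret_le {μ : Fin K → ℝ} {i : Fin K} (hmax : ∀ j, μ j ≤ μ i) (c : ℝ) {T : ℕ}
    (hT : ⌈c⌉₊ * K ≤ T) (ω : Ω) :
    D.regret c μ i T ω ≤ (∑ j, (μ i - μ j)) * ((⌈c⌉₊ * K : ℕ) +
      D.exploreCount (⌈c⌉₊ * K) T ω + D.greedyErrors i (⌈c⌉₊ * K) T ω) := by
  set n := ⌈c⌉₊ * K with hn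
  have hgap (j : Fin K) : μ i - μ j ≤ ∑ j, (μ i - μ j) :=
    Finset.single_le_sum (f := fun j => μ i - μ j) (fun j _ => sub_nonneg.2 (hmax j))
      (Finset.mem_univ j)
  have h0 : 0 ≤ ∑ j, (μ i - μ j) := Finset.sum_nonneg fun j _ => sub_nonneg.2 (hmax j)
  have hsum : D.regret c μ i T ω = ∑ t ∈ Finset.Icc 1 T, (μ i - μ (D.arm c t ω)) := by
    simp [regret, mul_comm]
  have hIcc : Finset.Icc 1 T = Finset.Ioc 0 n ∪ Finset.Ioc n T := by
    ext t; simp only [Finset.mem_Icc, Finset.mem_union, Finset.mem_Ioc]; omega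
  rw [hsum, hIcc, Finset.sum_union (Finset.Ioc_disjoint_Ioc_of_le le_rfl), mul_add, mul_add,
    add_assoc, ← mul_add]
  gcongr
  · refine (Finset.sum_le_sum fun t _ => hgap _).trans ?_
    rw [Finset.sum_const, Nat.card_Ioc, Nat.sub_zero, nsmul_eq_mul, mul_comm]
  · rw [exploreCount, greedyErrors, Finset.card_filter, Finset.card_filter]
    push_cast
    rw [← Finset.sum_add_distrib, Finset.mul_sum]
    refine Finset.sum_le_sum fun t ht => ?_
    have ht' : ¬ t ≤ ⌈c⌉₊ * K := not_le.2 (Finset.mem_Ioc.1 ht).1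
    rw [arm, if_neg ht']
    by_cases hE : D.explore t ω = true
    · simp only [hE, if_true]
      have := hgap (D.uniformArm t ω)
      split_ifs <;> linarith
    · by_cases hG : D.greedyArm t ω = i
      · simp [hE, hG]
      · simpa [hE, hG] using hgap _

end Play

/-! ### Counting explorations and greedy errors; the two regret bounds -/

namespace IsMedEpsGreedy

variable {K : ℕ} {Ω : Type u} [mΩ : MeasurableSpace Ω] {P : Measure Ω}
  {ℱ : Filtration ℕ mΩ} {μ : Fin K → ℝ} {σ ρ c : ℝ} {T : ℕ} {D : Play K Ω}

lemma pullRounds_nonempty (H : IsMedEpsGreedy P ℱ μ σ ρ c T D) (hc : 0 < c) {t : ℕ}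
    (h0 : ⌈c⌉₊ * K ≤ t) (i : Fin K) (ω : Ω) : (D.pullRounds c i t ω).Nonempty := by
  have h1 : ((Finset.Icc 1 (⌈c⌉₊ * K)).filter fun t => D.init t = i).Nonempty := by
    rw [← Finset.card_pos, H.init_count i]
    exact Nat.ceil_pos.2 hc
  refine h1.mono fun τ hτ => ?_
  simp only [Finset.mem_filter, Finset.mem_Icc, Play.pullRounds] at hτ ⊢
  exact ⟨⟨hτ.1.1, hτ.1.2.trans h0⟩, by rw [Play.arm, if_pos hτ.1.2, hτ.2]⟩

lemma one_le_score_of_le_med (H : IsMedEpsGreedy P ℱ μ σ ρ c T D) (hc : 0 < c) {t : ℕ}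
    (h0 : ⌈c⌉₊ * K ≤ t) {i : Fin K} {ω : Ω} {x a : ℝ} (ha : 1 ≤ a) (h : x ≤ D.med c i t ω) :
    1 ≤ D.score c i (Set.Ici x) a t ω := by
  classical
  refine D.one_le_score ha ((card_le_of_le_sampleMedian
    (H.pullRounds_nonempty hc h0 i ω) h).trans ?_)
  refine Nat.mul_le_mul_left 2 (Finset.card_le_card fun τ hτ => ?_)
  obtain ⟨h1, h2⟩ := Finset.mem_filter.1 hτ
  refine Finset.mem_filter.2 ⟨h1, ?_⟩
  rw [Play.observed, (Finset.mem_filter.1 h1).2] at h2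
  by_cases hA : D.attack τ ω = true
  · exact Or.inl hA
  · exact Or.inr (by simpa [hA] using h2)

lemma one_le_score_of_med_lt (H : IsMedEpsGreedy P ℱ μ σ ρ c T D) (hc : 0 < c) {t : ℕ}
    (h0 : ⌈c⌉₊ * K ≤ t) {i : Fin K} {ω : Ω} {x a : ℝ} (ha : 1 ≤ a) (h : D.med c i t ω < x) :
    1 ≤ D.score c i (Set.Iio x) a t ω := by
  classical
  refine D.one_le_score ha ((card_le_of_sampleMedian_lt
    (H.pullRounds_nonempty hc h0 i ω) h).trans ?_)
  refine Nat.mul_le_mul_left 2 (Finset.card_le_card fun τ hτ => ?_)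
  obtain ⟨h1, h2⟩ := Finset.mem_filter.1 hτ
  refine Finset.mem_filter.2 ⟨h1, ?_⟩
  rw [Play.observed, (Finset.mem_filter.1 h1).2] at h2
  by_cases hA : D.attack τ ω = true
  · exact Or.inl hA
  · exact Or.inr (by simpa [hA] using h2)

lemma measurableSet_explore (H : IsMedEpsGreedy P ℱ μ σ ρ c T D) {t : ℕ} (ht : t < T) :
    MeasurableSet {ω | D.explore (t + 1) ω = true} :=
  (H.measurable_explore t ht).mono (ℱ.le _) le_rfl (measurableSet_singleton true)

lemma measurableSet_greedyArm_ne (H : IsMedEpsGreedy P ℱ μ σ ρ c T D) {t : ℕ} (ht : t < T)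
    (i : Fin K) : MeasurableSet {ω | D.greedyArm (t + 1) ω ≠ i} :=
  (H.measurable_greedyArm t ht).mono (ℱ.le _) le_rfl (measurableSet_singleton i).compl

variable [IsProbabilityMeasure P]

lemma integrable_card_filter {s : Finset ℕ} {p : ℕ → Ω → Prop} [∀ t ω, Decidable (p t ω)]
    (hp : ∀ t ∈ s, MeasurableSet {ω | p t ω}) :
    Integrable (fun ω => ((s.filter fun t => p t ω).card : ℝ)) P := by
  simp_rw [Finset.card_filter]
  push_cast
  refine integrable_finsetSum _ fun t ht => ?_
  simpa using integrable_mul_ite (integrable_const (1 : ℝ)) (hp t ht)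

lemma integral_card_filter {s : Finset ℕ} {p : ℕ → Ω → Prop} [∀ t ω, Decidable (p t ω)]
    (hp : ∀ t ∈ s, MeasurableSet {ω | p t ω}) :
    ∫ ω, ((s.filter fun t => p t ω).card : ℝ) ∂P = ∑ t ∈ s, P.real {ω | p t ω} := by
  simp_rw [Finset.card_filter]
  push_cast
  rw [integral_finsetSum _ fun t ht => by
    simpa using integrable_mul_ite (integrable_const (1 : ℝ)) (hp t ht)]
  exact Finset.sum_congr rfl fun t ht => integral_ite (hp t ht)

lemma integrable_exploreCount (H : IsMedEpsGreedy P ℱ μ σ ρ c T D) {n : ℕ} :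
    Integrable (fun ω => (D.exploreCount n T ω : ℝ)) P := by
  refine integrable_card_filter fun t ht => ?_
  obtain ⟨h1, h2⟩ := Finset.mem_Ioc.1 ht
  obtain ⟨s, rfl⟩ := Nat.exists_eq_add_of_le' (show 1 ≤ t by omega)
  exact H.measurableSet_explore h2

lemma integrable_greedyErrors (H : IsMedEpsGreedy P ℱ μ σ ρ c T D) {i : Fin K} {n : ℕ} :
    Integrable (fun ω => (D.greedyErrors i n T ω : ℝ)) P := by
  refine integrable_card_filter fun t ht => ?_
  obtain ⟨h1, h2⟩ := Finset.mem_Ioc.1 ht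
  obtain ⟨s, rfl⟩ := Nat.exists_eq_add_of_le' (show 1 ≤ t by omega)
  exact H.measurableSet_greedyArm_ne h2 i

lemma integral_exploreCount_le (H : IsMedEpsGreedy P ℱ μ σ ρ c T D) (hc : 0 < c) (hK : 0 < K)
    (hT : ⌈c⌉₊ * K ≤ T) :
    ∫ ω, (D.exploreCount (⌈c⌉₊ * K) T ω : ℝ) ∂P ≤ c * K * Real.log T := by
  unfold Play.exploreCount
  rw [integral_card_filter]
  · have h1 := sum_Ioc_inv_le_log (Nat.mul_pos (Nat.ceil_pos.2 hc) hK) hT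
    refine le_trans (le_of_eq ?_) (mul_le_mul_of_nonneg_left h1 (by positivity))
    rw [Finset.mul_sum]
    refine Finset.sum_congr rfl fun t ht => ?_
    obtain ⟨h1, h2⟩ := Finset.mem_Ioc.1 ht
    obtain ⟨s, rfl⟩ := Nat.exists_eq_add_of_le' (show 1 ≤ t by omega)
    rw [H.law_explore s h2 h1, mul_one_div]
  · intro t ht
    obtain ⟨h1, h2⟩ := Finset.mem_Ioc.1 ht
    obtain ⟨s, rfl⟩ := Nat.exists_eq_add_of_le' (show 1 ≤ t by omega)
    exact H.measurableSet_explore h2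

lemma measureReal_exploreCount_ge_le (H : IsMedEpsGreedy P ℱ μ σ ρ c T D) (hc : 0 < c)
    (hK : 0 < K) (hT : ⌈c⌉₊ * K ≤ T) {δ : ℝ} (hδ : 0 < δ) :
    P.real {ω | 2 * (c * K * Real.log T + 2 / δ) ≤ D.exploreCount (⌈c⌉₊ * K) T ω} ≤ δ / 2 := by
  set E := Real.exp (c * K * Real.log T) with hE
  have hE0 : 0 < E := Real.exp_pos _
  have hint : ∫ ω, D.exploreScore (⌈c⌉₊ * K) T ω ∂P ≤ E := by
    refine (H.integral_exploreScore_le hc.le le_rfl hT).trans (Real.exp_le_exp.2 ?_)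
    exact mul_le_mul_of_nonneg_left
      (sum_Ioc_inv_le_log (Nat.mul_pos (Nat.ceil_pos.2 hc) hK) hT) (by positivity)
  have hmarkov := mul_meas_ge_le_integral_of_nonneg
    (ae_of_all P fun ω => (D.exploreScore_pos (n := ⌈c⌉₊ * K) (t := T) (ω := ω)).le)
    (H.integrable_exploreScore le_rfl) (E * (2 / δ))
  have hle : P.real {ω | E * (2 / δ) ≤ D.exploreScore (⌈c⌉₊ * K) T ω} ≤ δ / 2 := by
    have h1 := hmarkov.trans hint
    rw [mul_assoc, mul_le_iff_le_one_right hE0, div_mul_eq_mul_div, div_le_one hδ] at h1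
    linarith
  refine (measureReal_mono fun ω hω => ?_).trans hle
  simp only [Set.mem_ofPred_eq] at hω ⊢
  -- The factor `2` in the threshold on the count makes up for `log 2 ≥ 1 / 2`, and `2 / δ ≤ exp (2
  -- / δ)` replaces `log (2 / δ)` by `2 / δ`.
  have h2 : (0.5 : ℝ) ≤ Real.log 2 := by linarith [Real.log_two_gt_d9]
  rw [Play.exploreScore_eq]
  change _ ≤ (2 : ℝ) ^ (D.exploreCount (⌈c⌉₊ * K) T ω)
  rw [← Real.rpow_natCast, Real.rpow_def_of_pos two_pos]
  have h3 : E * (2 / δ) ≤ Real.exp (c * K * Real.log T + 2 / δ) := by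
    rw [Real.exp_add]
    gcongr
    linarith [Real.add_one_le_exp (2 / δ)]
  refine h3.trans (Real.exp_le_exp.2 ?_)
  have h4 : (0 : ℝ) ≤ D.exploreCount (⌈c⌉₊ * K) T ω := Nat.cast_nonneg _
  nlinarith

lemma measureReal_greedyArm_ne_le (H : IsMedEpsGreedy P ℱ μ σ ρ c T D) (hK : 2 ≤ K) (hc : 0 < c)
    {iStar : Fin K} {x g : ℝ} (hg : 0 < g) (hcg : 1 ≤ c * g ^ 2)
    (hopt : (gaussianReal (μ iStar) (σ ^ 2).toNNReal).real (Set.Iio x) + ρ ≤ 1 / 2 - g)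
    (hsub : ∀ i ≠ iStar, (gaussianReal (μ i) (σ ^ 2).toNNReal).real (Set.Ici x) + ρ ≤ 1 / 2 - g)
    {t : ℕ} (ht : t < T) (h0 : ⌈c⌉₊ * K ≤ t) :
    P.real {ω | D.greedyArm (t + 1) ω ≠ iStar} ≤
      K * ((⌈c⌉₊ * K : ℕ) : ℝ) ^ 2 * (1 / ((t : ℝ) * (t - 1))) := by
  classical
  set B : Fin K → Set ℝ := fun i => if i = iStar then Set.Iio x else Set.Ici x with hBdef
  have ha : 1 ≤ 1 + 2 * g := by linarith
  have hB (i : Fin K) : MeasurableSet (B i) := by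
    simp only [hBdef]
    split_ifs
    exacts [measurableSet_Iio, measurableSet_Ici]
  have hprob (i : Fin K) :
      (gaussianReal (μ i) (σ ^ 2).toNNReal).real (B i) + ρ ≤ 1 / 2 - g := by
    simp only [hBdef]
    split_ifs with h
    · rw [h]; exact hopt
    · exact hsub i h
  have ht2 : (2 : ℝ) ≤ t := by
    have : 1 * 2 ≤ ⌈c⌉₊ * K := Nat.mul_le_mul (Nat.ceil_pos.2 hc) hK
    exact_mod_cast (by omega : 2 ≤ t)
  have hpos : (0 : ℝ) < t * (t - 1) := mul_pos (by linarith) (by linarith)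
  have hcover : {ω | D.greedyArm (t + 1) ω ≠ iStar} ⊆
      ⋃ i ∈ (Finset.univ : Finset (Fin K)), {ω | 1 ≤ D.score c i (B i) (1 + 2 * g) t ω} := by
    intro ω hω
    simp only [Set.mem_iUnion, Finset.mem_univ, exists_true_left]
    -- Either the best arm's median is too low, or the greedy arm, whose median is at least as
    -- large, is a suboptimal arm with median at least `x`.
    rcases lt_or_ge (D.med c iStar t ω) x with h | h
    · refine ⟨iStar, ?_⟩
      simp only [hBdef, if_true]
      exact H.one_le_score_of_med_lt hc h0 ha h
    · refine ⟨D.greedyArm (t + 1) ω, ?_⟩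
      simp only [hBdef, if_neg hω]
      exact H.one_le_score_of_le_med hc h0 ha
        (h.trans (H.greedy_max t ht (by omega) ω iStar))
  refine (measureReal_mono hcover (measure_ne_top P _)).trans
    ((measureReal_biUnion_finset_le _ _).trans ?_)
  have hone (i : Fin K) : P.real {ω | 1 ≤ D.score c i (B i) (1 + 2 * g) t ω} ≤
      ((⌈c⌉₊ * K : ℕ) : ℝ) ^ 2 * (1 / ((t : ℝ) * (t - 1))) := by
    have h1 := mul_meas_ge_le_integral_of_nonneg
      (ae_of_all P fun ω => (D.score_pos (c := c) (i := i) (B := B i) (t := t) (ω := ω)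
        (show 0 < 1 + 2 * g by linarith)).le) (H.integrable_score (hB i) ha ht.le) 1
    rw [one_mul] at h1
    refine h1.trans ?_
    rw [mul_one_div, le_div_iff₀ hpos, mul_comm]
    exact H.integral_score_le (by omega) (hB i) hg hcg (hprob i) ht.le h0
  refine (Finset.sum_le_sum fun i _ => hone i).trans (le_of_eq ?_)
  simp [mul_assoc]

lemma integral_greedyErrors_le (H : IsMedEpsGreedy P ℱ μ σ ρ c T D) (hK : 2 ≤ K) (hc : 0 < c)
    {iStar : Fin K} {x g : ℝ} (hg : 0 < g) (hcg : 1 ≤ c * g ^ 2)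
    (hopt : (gaussianReal (μ iStar) (σ ^ 2).toNNReal).real (Set.Iio x) + ρ ≤ 1 / 2 - g)
    (hsub : ∀ i ≠ iStar,
      (gaussianReal (μ i) (σ ^ 2).toNNReal).real (Set.Ici x) + ρ ≤ 1 / 2 - g) :
    ∫ ω, (D.greedyErrors iStar (⌈c⌉₊ * K) T ω : ℝ) ∂P ≤ K * ((⌈c⌉₊ * K : ℕ) : ℝ) ^ 2 := by
  unfold Play.greedyErrors
  rw [integral_card_filter]
  · have hn : 1 * 2 ≤ ⌈c⌉₊ * K := Nat.mul_le_mul (Nat.ceil_pos.2 hc) hK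
    -- The greedy arm of round `t + 1` is judged by the medians after round `t`.
    have hIoc : Finset.Ioc (⌈c⌉₊ * K) T = (Finset.Ico (⌈c⌉₊ * K) T).image (· + 1) := by
      simp only [Finset.image_add_right_Ico]
      ext t; simp only [Finset.mem_Ioc, Finset.mem_Ico]; omega
    rw [hIoc, Finset.sum_image fun _ _ _ _ h => Nat.succ_injective h]
    refine (Finset.sum_le_sum fun t ht => H.measureReal_greedyArm_ne_le hK hc hg hcg hopt hsub
      (Finset.mem_Ico.1 ht).2 (Finset.mem_Ico.1 ht).1).trans ?_
    rw [← Finset.mul_sum]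
    exact mul_le_of_le_one_right (by positivity) (sum_Ico_inv_mul_pred_le (by omega))
  · intro t ht
    obtain ⟨h1, h2⟩ := Finset.mem_Ioc.1 ht
    obtain ⟨s, rfl⟩ := Nat.exists_eq_add_of_le' (show 1 ≤ t by omega)
    exact H.measurableSet_greedyArm_ne h2 iStar

lemma pseudoRegret_eq (H : IsMedEpsGreedy P ℱ μ σ ρ c T D) (i : Fin K) :
    Integrable (D.regret c μ i T) P ∧ D.pseudoRegret P c μ i T = ∫ ω, D.regret c μ i T ω ∂P := by
  have hint : Integrable (fun ω => ∑ t ∈ Finset.Icc 1 T, μ (D.arm c t ω)) P := by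
    refine integrable_finsetSum _ fun t ht => ?_
    obtain ⟨h1, h2⟩ := Finset.mem_Icc.1 ht
    obtain ⟨s, rfl⟩ := Nat.exists_eq_add_of_le' h1
    have hm : Measurable (D.arm c (s + 1)) := (H.measurable_arm h2).mono (ℱ.le _) le_rfl
    refine Integrable.of_bound ((measurable_of_finite μ).comp hm).aestronglyMeasurable
      (∑ j, ‖μ j‖) (ae_of_all _ fun ω => ?_)
    exact Finset.single_le_sum (f := fun j => ‖μ j‖) (fun j _ => norm_nonneg _)
      (Finset.mem_univ (D.arm c (s + 1) ω))
  refine ⟨(integrable_const _).sub hint, ?_⟩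
  unfold Play.regret
  rw [integral_sub (integrable_const _) hint, Play.pseudoRegret]
  simp

lemma pseudoRegret_le (H : IsMedEpsGreedy P ℱ μ σ ρ c T D) (hK : 2 ≤ K) (hc : 0 < c)
    {iStar : Fin K} (hmax : ∀ j, μ j ≤ μ iStar) {x g : ℝ} (hg : 0 < g) (hcg : 1 ≤ c * g ^ 2)
    (hopt : (gaussianReal (μ iStar) (σ ^ 2).toNNReal).real (Set.Iio x) + ρ ≤ 1 / 2 - g)
    (hsub : ∀ i ≠ iStar, (gaussianReal (μ i) (σ ^ 2).toNNReal).real (Set.Ici x) + ρ ≤ 1 / 2 - g)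
    (hT : ⌈c⌉₊ * K ≤ T) :
    D.pseudoRegret P c μ iStar T ≤ (∑ j, (μ iStar - μ j)) * ((⌈c⌉₊ * K : ℕ) +
      c * K * Real.log T + K * ((⌈c⌉₊ * K : ℕ) : ℝ) ^ 2) := by
  obtain ⟨hint, heq⟩ := H.pseudoRegret_eq iStar
  have h0 : 0 ≤ ∑ j, (μ iStar - μ j) := Finset.sum_nonneg fun j _ => sub_nonneg.2 (hmax j)
  have hE := H.integrable_exploreCount (n := ⌈c⌉₊ * K)
  have hG := H.integrable_greedyErrors (i := iStar) (n := ⌈c⌉₊ * K)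
  have hcE : Integrable (fun ω => ((⌈c⌉₊ * K : ℕ) : ℝ) + D.exploreCount (⌈c⌉₊ * K) T ω) P :=
    (integrable_const _).add hE
  rw [heq]
  refine (integral_mono hint ((hcE.add hG).const_mul _)
    fun ω => D.regret_le hmax c hT ω).trans ?_
  simp only [Pi.add_apply]
  rw [integral_const_mul, integral_add hcE hG, integral_add (integrable_const _) hE]
  gcongr
  · simp
  · exact H.integral_exploreCount_le hc (by omega) hT
  · exact H.integral_greedyErrors_le hK hc hg hcg hopt hsub

/-- The failure probability `δ` is split evenly between too many explorations and too many greedy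
errors. -/
lemma le_measureReal_regret_le (H : IsMedEpsGreedy P ℱ μ σ ρ c T D) (hK : 2 ≤ K) (hc : 0 < c)
    {iStar : Fin K} (hmax : ∀ j, μ j ≤ μ iStar) {x g : ℝ} (hg : 0 < g) (hcg : 1 ≤ c * g ^ 2)
    (hopt : (gaussianReal (μ iStar) (σ ^ 2).toNNReal).real (Set.Iio x) + ρ ≤ 1 / 2 - g)
    (hsub : ∀ i ≠ iStar, (gaussianReal (μ i) (σ ^ 2).toNNReal).real (Set.Ici x) + ρ ≤ 1 / 2 - g)
    (hT : ⌈c⌉₊ * K ≤ T) {δ : ℝ} (hδ : 0 < δ) :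
    1 - δ ≤ P.real {ω | D.regret c μ iStar T ω ≤ (∑ j, (μ iStar - μ j)) * ((⌈c⌉₊ * K : ℕ) +
      2 * (c * K * Real.log T + 2 / δ) + K * ((⌈c⌉₊ * K : ℕ) : ℝ) ^ 2 * (2 / δ))} := by
  have h0 : 0 ≤ ∑ j, (μ iStar - μ j) := Finset.sum_nonneg fun j _ => sub_nonneg.2 (hmax j)
  have hn : 0 < ⌈c⌉₊ * K := Nat.mul_pos (Nat.ceil_pos.2 hc) (by omega)
  have hC : (0 : ℝ) < K * ((⌈c⌉₊ * K : ℕ) : ℝ) ^ 2 := by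
    have h1 : (0 : ℝ) < (⌈c⌉₊ * K : ℕ) := by exact_mod_cast hn
    have h2 : (0 : ℝ) < K := by exact_mod_cast (by omega : 0 < K)
    positivity
  have hE := H.measureReal_exploreCount_ge_le hc (by omega) hT hδ
  have hG : P.real {ω | K * ((⌈c⌉₊ * K : ℕ) : ℝ) ^ 2 * (2 / δ) ≤
      (D.greedyErrors iStar (⌈c⌉₊ * K) T ω : ℝ)} ≤ δ / 2 := by
    have h1 := (mul_meas_ge_le_integral_of_nonneg (ae_of_all P fun ω => Nat.cast_nonneg _)
      (H.integrable_greedyErrors (i := iStar) (n := ⌈c⌉₊ * K))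
      (K * ((⌈c⌉₊ * K : ℕ) : ℝ) ^ 2 * (2 / δ))).trans
      (H.integral_greedyErrors_le hK hc hg hcg hopt hsub)
    rw [mul_assoc, mul_le_iff_le_one_right hC, div_mul_eq_mul_div, div_le_one hδ] at h1
    linarith
  have hcover : (Set.univ : Set Ω) ⊆ {ω | D.regret c μ iStar T ω ≤
      (∑ j, (μ iStar - μ j)) * ((⌈c⌉₊ * K : ℕ) + 2 * (c * K * Real.log T + 2 / δ) +
        K * ((⌈c⌉₊ * K : ℕ) : ℝ) ^ 2 * (2 / δ))} ∪
      ({ω | 2 * (c * K * Real.log T + 2 / δ) ≤ D.exploreCount (⌈c⌉₊ * K) T ω} ∪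
      {ω | K * ((⌈c⌉₊ * K : ℕ) : ℝ) ^ 2 * (2 / δ) ≤
        (D.greedyErrors iStar (⌈c⌉₊ * K) T ω : ℝ)}) := by
    intro ω _
    by_contra hω
    simp only [Set.mem_union, Set.mem_ofPred_eq, not_or, not_le] at hω
    obtain ⟨h1, h2, h3⟩ := hω
    refine absurd (D.regret_le hmax c hT ω) (not_le.2 (lt_of_le_of_lt ?_ h1))
    gcongr
  have h1 := (measureReal_mono (μ := P) hcover).trans (measureReal_union_le _ _)
  have h2 := measureReal_union_le (μ := P)
    {ω | 2 * (c * K * Real.log T + 2 / δ) ≤ D.exploreCount (⌈c⌉₊ * K) T ω}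
    {ω | K * ((⌈c⌉₊ * K : ℕ) : ℝ) ^ 2 * (2 / δ) ≤ (D.greedyErrors iStar (⌈c⌉₊ * K) T ω : ℝ)}
  rw [probReal_univ] at h1
  linarith

end IsMedEpsGreedy

end MedianBandit

/-! ### Choice of threshold and constants -/

theorem corollary2 {K : ℕ} (hK : 2 ≤ K) (μ : Fin K → ℝ) (iStar : Fin K)
    (hopt : ∀ j, j ≠ iStar → μ j < μ iStar)
    (σ : ℝ) (hσ : 0 < σ) (ρ : ℝ) (hρ0 : 0 < ρ)
    (hρ : ρ < MedianBandit.Phi (MedianBandit.minGap μ iStar / (4 * σ)) - 1 / 2)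
    (c : ℝ)
    (hc : max 10 (max
      (1 / (MedianBandit.Phi (MedianBandit.minGap μ iStar / (2 * σ))
        - MedianBandit.Phi (MedianBandit.minGap μ iStar / (4 * σ))) ^ 2)
      (1 / (MedianBandit.Phi (MedianBandit.minGap μ iStar / (4 * σ)) - 1 / 2 - ρ) ^ 2)) < c) :
    (∃ M > (0 : ℝ), ∃ ζ > (0 : ℝ), ∀ T : ℕ, ζ ≤ (T : ℝ) →
      ∀ (Ω : Type u) [mΩ : MeasurableSpace Ω] (P : Measure Ω) [IsProbabilityMeasure P]
        (ℱ : Filtration ℕ mΩ) (D : MedianBandit.Play K Ω),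
        MedianBandit.IsMedEpsGreedy P ℱ μ σ ρ c T D →
          D.pseudoRegret P c μ iStar T ≤ M * Real.log T) ∧
    (∃ M > (0 : ℝ), ∃ ζ > (0 : ℝ), ∀ T : ℕ, ζ ≤ (T : ℝ) → ∀ δ : ℝ, 0 < δ → δ < 1 →
      ∀ (Ω : Type u) [mΩ : MeasurableSpace Ω] (P : Measure Ω) [IsProbabilityMeasure P]
        (ℱ : Filtration ℕ mΩ) (D : MedianBandit.Play K Ω),
        MedianBandit.IsMedEpsGreedy P ℱ μ σ ρ c T D →
          1 - δ ≤ P.real {ω | D.regret c μ iStar T ω ≤ M * (Real.log T + 1 / δ)}) := by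
  classical
  have hc0 : 0 < c := by linarith [le_max_left (10 : ℝ) (max
      (1 / (MedianBandit.Phi (MedianBandit.minGap μ iStar / (2 * σ))
        - MedianBandit.Phi (MedianBandit.minGap μ iStar / (4 * σ))) ^ 2)
      (1 / (MedianBandit.Phi (MedianBandit.minGap μ iStar / (4 * σ)) - 1 / 2 - ρ) ^ 2))]
  have hc2 := (le_max_right _ _).trans ((le_max_right _ _).trans hc.le)
  set d := MedianBandit.minGap μ iStar with hd
  have hmax (j : Fin K) : μ j ≤ μ iStar := by
    rcases eq_or_ne j iStar with rfl | h
    exacts [le_rfl, (hopt j h).le]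
  have hgap (i : Fin K) (hi : i ≠ iStar) : d ≤ μ iStar - μ i :=
    ciInf_le (f := fun j : {j : Fin K // j ≠ iStar} => μ iStar - μ j)
      (Set.finite_range _).bddBelow ⟨i, hi⟩
  have hd0 : 0 ≤ d := Real.iInf_nonneg fun j => sub_nonneg.2 (hmax j)
  have hmono : MedianBandit.Phi (d / (4 * σ)) ≤ MedianBandit.Phi (d / 2 / σ) := by
    rw [div_div]
    refine MedianBandit.Phi_mono ?_
    gcongr
    norm_num
  set g := MedianBandit.Phi (d / (4 * σ)) - 1 / 2 - ρ with hgdef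
  have hg : 0 < g := by linarith
  have hcg : 1 ≤ c * g ^ 2 := by
    rwa [div_le_iff₀ (by positivity)] at hc2
  -- The threshold is at distance at least `d / 2` from every mean. Each wrong-side tail is thus at
  -- most `1 - Phi (d / 2 / σ) ≤ 1 - Phi (d / (4 * σ)) = 1 / 2 - ρ - g`.
  have hbest : (gaussianReal (μ iStar) (σ ^ 2).toNNReal).real (Set.Iio (μ iStar - d / 2)) + ρ
      ≤ 1 / 2 - g := by
    have := MedianBandit.measureReal_Iio_gaussianReal_le (m := μ iStar) hσ
      (le_refl (μ iStar - d / 2))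
    linarith
  have hsub (i : Fin K) (hi : i ≠ iStar) :
      (gaussianReal (μ i) (σ ^ 2).toNNReal).real (Set.Ici (μ iStar - d / 2)) + ρ ≤ 1 / 2 - g := by
    have := MedianBandit.measureReal_Ici_gaussianReal_le (m := μ i) (x := μ iStar - d / 2)
      (d := d / 2) hσ (by linarith [hgap i hi])
    linarith
  set G := ∑ j, (μ iStar - μ j) with hG
  have hG0 : 0 ≤ G := Finset.sum_nonneg fun j _ => sub_nonneg.2 (hmax j)
  set n := ⌈c⌉₊ * K with hn
  -- Since `3 > e`, the logarithm is at least `1` and absorbs the additive constants.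
  have hlog {T : ℕ} (hT : ((n : ℝ) + 3) ≤ T) : n ≤ T ∧ 1 ≤ Real.log T := by
    have h1 : n + 3 ≤ T := by exact_mod_cast hT
    refine ⟨by omega, ?_⟩
    have h2 : (3 : ℝ) ≤ T := by exact_mod_cast (by omega : 3 ≤ T)
    rw [Real.le_log_iff_exp_le (by linarith)]
    linarith [Real.exp_one_lt_d9]
  -- The summand `1` makes `M` positive using only `0 ≤ G`.
  refine ⟨⟨G * (n + c * K + K * (n : ℝ) ^ 2) + 1, by positivity, n + 3, by positivity, ?_⟩,
    ⟨G * (n + 2 * (c * K) + 4 + 2 * (K * (n : ℝ) ^ 2)) + 1, by positivity, n + 3, by positivity,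
      ?_⟩⟩
  · intro T hT Ω _ P _ ℱ D H
    obtain ⟨hnT, hL⟩ := hlog hT
    refine (H.pseudoRegret_le hK hc0 hmax hg hcg hbest hsub hnT).trans ?_
    have h1 : (n : ℝ) ≤ n * Real.log T := le_mul_of_one_le_right (by positivity) hL
    have h2 : K * (n : ℝ) ^ 2 ≤ K * (n : ℝ) ^ 2 * Real.log T :=
      le_mul_of_one_le_right (by positivity) hL
    calc G * (n + c * K * Real.log T + K * (n : ℝ) ^ 2)
        ≤ G * (n * Real.log T + c * K * Real.log T + K * (n : ℝ) ^ 2 * Real.log T) := by gcongr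
      _ = G * (n + c * K + K * (n : ℝ) ^ 2) * Real.log T := by ring
      _ ≤ (G * (n + c * K + K * (n : ℝ) ^ 2) + 1) * Real.log T := by gcongr; linarith
  · intro T hT δ hδ hδ1 Ω _ P _ ℱ D H
    obtain ⟨hnT, hL⟩ := hlog hT
    refine (H.le_measureReal_regret_le hK hc0 hmax hg hcg hbest hsub hnT hδ).trans
      (measureReal_mono fun ω hω => ?_)
    rw [Set.mem_ofPred_eq] at hω ⊢
    refine hω.trans ?_
    have hL0 : 0 ≤ Real.log T := by linarith
    have hδ2 : 0 < 1 / δ := by positivity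
    set L := Real.log T
    set r := 1 / δ
    have hr : 2 / δ = 2 * r := by simp only [r]; ring
    rw [hr]
    have h1 : (n : ℝ) ≤ n * (L + r) := le_mul_of_one_le_right (by positivity) (by linarith)
    have h2 : c * K * L ≤ c * K * (L + r) := by gcongr; linarith
    have h3 : r ≤ L + r := by linarith
    have h4 : K * (n : ℝ) ^ 2 * r ≤ K * (n : ℝ) ^ 2 * (L + r) := by gcongr
    calc G * (n + 2 * (c * K * L + 2 * r) + K * (n : ℝ) ^ 2 * (2 * r))
        ≤ G * (n * (L + r) + 2 * (c * K * (L + r) + 2 * (L + r)) +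
          2 * (K * (n : ℝ) ^ 2 * (L + r))) :=
          mul_le_mul_of_nonneg_left (by linarith) hG0
      _ = G * (n + 2 * (c * K) + 4 + 2 * (K * (n : ℝ) ^ 2)) * (L + r) := by ring
      _ ≤ (G * (n + 2 * (c * K) + 4 + 2 * (K * (n : ℝ) ^ 2)) + 1) * (L + r) := by
        gcongr; linarith
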